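/- Let $\mathbb P=\mathbb P(w_1,\ldots,w_n)$, $n=d+1$, be a $d$-dimensional weighted projective space with positive integer weights such that $\gcd(w_1,\ldots,w_n)=1$ and $w_i\mid w_1+\cdots+w_n$ for all $i$. Its fan has rays generated by vectors $v_1,\ldots,v_n$ which generate a lattice $M\cong\mathbb Z^d$ and satisfy $w_1v_1+\cdots+w_nv_n=0$, and its cones are spanned by the proper subsets of $\{v_1,\ldots,v_n\}$. Let $D_i$ be the toric divisor of $v_i$. Let $\{v_1,\ldots,v_n\}=A_1\sqcup\cdots\sqcup A_r$ be a decomposition into nonempty subsets (for example one that defines a nef-partition, which is the case $w_i\mid d_j$ for all $i,j$), and put $E_j=\sum_{v_i\in A_j}D_i$ and $d_j=\sum_{v_i\in A_j}w_i$. For a lattice point $\beta=(\beta_1,\ldots,\beta_n)$ of the Mori cone $K_{\rm eff}(\mathbb P)\subset\{\beta:\sum_i\beta_iv_i=0\}$, where $(D_i,\beta)=\beta_i$, let $\mathbb P_\beta$ be the Morrison–Plesser moduli space. This is the toric quotient of $\bigoplus_i H^0(\mathbb P^1,\mathcal O(\beta_i))$ by the group $\mathrm{Hom}(\mathrm{Cl}(\mathbb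 P),\mathbb C^*)$, restricted to those tuples of sections $(s_i)$ for which $\{v_i : s_i\equiv 0\}$ spans a cone of the fan. Denote again by $[D_i]\in H^2(\mathbb P_\beta,\mathbb Q)$ the image of $[D_i]$ under the canonical map $H^2(\mathbb P,\mathbb Q)\to H^2(\mathbb P_\beta,\mathbb Q)$. Here the rational cohomology ring of a complete simplicial toric variety is taken in its Danilov–Jurkiewicz form (polynomials in the toric divisors modulo the Stanley–Reisner relations and linear equivalence), and integration is normalized so that the toric divisors corresponding to the rays of a maximal cone $\sigma$ have intersection number $1/\mathrm{mult}(\sigma)$. Let $$\Phi_\beta=\prod_{j=1}^r[E_j]^{(E_j,\beta)}\prod_{i:(D_i,\beta)<0}[D_i]^{-(D_i,\beta)-1}$$ be the Morrison–Plesser class. For a homogeneous polynomial $P\in\mathbb Q[x_1,\ldots,x_n]$ of degree $d$ put $$I(P,\beta)=\int_{\mathbb P_\beta}P([D_1],\ldots,[D_n])\,\Phi_\beta,\qquad I_P=\sum_{\beta\in K_{\rm eff}(\mathbb P)}I(P,\beta)\,a^\beta,$$ the sum being over the lattice points of the Mori cone. Then the lattice points of $K_{\rm eff}(\mathbb P)$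 are exactly $\beta=(bw_1,\ldots,bw_n)$ with $b\in\mathbb Z_{\ge0}$. For such $\beta$ the space $\mathbb P_\beta$ is the weighted projective space in which each weight $w_i$ is repeated $bw_i+1$ times, there is exactly one integration functional on $H^*(\mathbb P_\beta,\mathbb Q)$, and there is a class $[D_0]$ with $[D_i]=w_i[D_0]$ for all $i$ and $$\Phi_\beta=\prod_{j=1}^r(d_j[D_0])^{d_jb}.$$ Moreover, with $\nu=\frac1{w_1\cdots w_n}$, $\mu=\frac{d_1^{d_1}\cdots d_r^{d_r}}{w_1^{w_1}\cdots w_n^{w_n}}$ and $y=a_1^{w_1}\cdots a_n^{w_n}$, one has $I(P,\beta)=\nu\,P(w_1,\ldots,w_n)\,\mu^b$, and hence $$I_P(y)=\nu\,P(w_1,\ldots,w_n)\sum_{b\ge0}\mu^by^b=\frac{\nu\,P(w_1,\ldots,w_n)}{1-\mu y},$$ both as formal power series in $a_1,\ldots,a_n$ and as a convergent sum for all $a\in\mathbb C^n$ with $|\mu y|<1$. -/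

import Mathlib

noncomputable section

open scoped Classical

/-- The combinatorial data of a (simplicial) fan in the lattice `M`: the generators `v_i` of its
rays, and the collection of those sets of indices whose generators span a cone of the fan.
It stands for the associated simplicial toric variety. -/
structure ToricFan (M : Type*) (ι : Type*) [AddCommGroup M] where
  /-- the generator `v_i` of the `i`-th ray -/
  ray : ι → M
  /-- the sets of rays spanning a cone -/
  cones : Set (Finset ι)

/-- `F` is the fan of the weighted projective space `ℙ(w_i : i ∈ ι)`: the weights are positive with
greatest common divisor `1`, the lattice has rank `|ι| - 1` and is generated by the `v_i`, which
satisfy `∑ w_i v_i = 0`, and the cones are spanned by the proper subsets of the set of rays. -/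
structure ToricFan.IsWeightedProjectiveSpace {M ι : Type*} [AddCommGroup M] [Fintype ι]
    (F : ToricFan M ι) (w : ι → ℕ) : Prop where
  pos : ∀ i, 0 < w i
  gcd_eq_one : Finset.univ.gcd w = 1
  rank : Module.finrank ℤ M + 1 = Fintype.card ι
  span_eq_top : Submodule.span ℤ (Set.range F.ray) = ⊤
  relation : ∑ i, w i • F.ray i = 0
  cones_eq : F.cones = {S | S ≠ Finset.univ}

namespace ToricFan

variable {M ι : Type*} [AddCommGroup M] [Fintype ι]

/-! ### The rational cohomology ring and intersection numbers -/

/-- The Stanley-Reisner ideal: generated by the monomials `∏_{i ∈ S} x_i` for which the rays in `S`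
do not span a cone. -/
def stanleyReisnerIdeal (F : ToricFan M ι) : Ideal (MvPolynomial ι ℚ) :=
  Ideal.span {p | ∃ S : Finset ι, S ∉ F.cones ∧ p = ∏ i ∈ S, MvPolynomial.X i}

/-- The ideal of linear equivalence: generated by the divisors `∑ ⟨m, v_i⟩ x_i` of the characters
`m` of the torus. -/
def linearIdeal (F : ToricFan M ι) : Ideal (MvPolynomial ι ℚ) :=
  Ideal.span {p | ∃ m : M →ₗ[ℤ] ℤ, p = ∑ i, MvPolynomial.C (m (F.ray i) : ℚ) * MvPolynomial.X i}

/-- The rational cohomology ring (equivalently, rational Chow ring) `H^*(ℙ, ℚ)` of a complete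
simplicial toric variety `ℙ`, in the Danilov-Jurkiewicz form: generated by the classes `x_i` of the
toric divisors, modulo the Stanley-Reisner relations and linear equivalence.
The cohomological degree is twice the polynomial degree. -/
abbrev Cohomology (F : ToricFan M ι) : Type _ :=
  MvPolynomial ι ℚ ⧸ (F.stanleyReisnerIdeal ⊔ F.linearIdeal)

/-- The class in `H^*(ℙ, ℚ)` of a polynomial in the toric divisors. -/
abbrev toCohomology (F : ToricFan M ι) : MvPolynomial ι ℚ →ₐ[ℚ] F.Cohomology :=
  Ideal.Quotient.mkₐ ℚ _

/-- The dimension of the toric variety. -/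
abbrev dim (_F : ToricFan M ι) : ℕ := Module.finrank ℤ M

/-- The set of (full-dimensional) maximal cones. -/
def maxCones (F : ToricFan M ι) : Set (Finset ι) := {σ | σ ∈ F.cones ∧ σ.card = F.dim}

/-- The multiplicity of a maximal cone: the index in `M` of the sublattice generated by its rays. -/
def mult (F : ToricFan M ι) (σ : Finset ι) : ℕ :=
  Nat.card (M ⧸ Submodule.span ℤ (F.ray '' (σ : Set ι)))

/-- `φ` is integration over the toric variety: it is `ℚ`-linear, vanishes on classes that are not of
top degree, and the toric divisors through the fixed point of a maximal cone `σ` intersect with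
multiplicity `1 / mult σ`. -/
structure IsIntegration (F : ToricFan M ι) (φ : F.Cohomology →ₗ[ℚ] ℚ) : Prop where
  eq_zero_of_ne : ∀ (k : ℕ) (p : MvPolynomial ι ℚ), p.IsHomogeneous k → k ≠ F.dim →
    φ (F.toCohomology p) = 0
  maxCone : ∀ σ ∈ F.maxCones,
    φ (F.toCohomology (∏ i ∈ σ, MvPolynomial.X i)) = 1 / (F.mult σ : ℚ)

/-- Integration `∫_ℙ : H^*(ℙ, ℚ) → ℚ`. A complete simplicial fan has exactly one functional as in
`IsIntegration`. If there is no cone at all (the empty variety), the cohomology ring is zero, and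
hence so are all integrals. -/
def integral (F : ToricFan M ι) : F.Cohomology →ₗ[ℚ] ℚ :=
  if h : ∃ φ, F.IsIntegration φ then h.choose else 0

/-! ### The Mori cone -/

/-- The toric divisor `∑ a_i D_i` is nef: its support function is convex, i.e. the linear function
that describes it on a maximal cone is, up to sign, a bound for it everywhere. -/
def IsNef (F : ToricFan M ι) (a : ι → ℚ) : Prop :=
  ∀ σ ∈ F.maxCones, ∃ m : M →ₗ[ℤ] ℚ,
    (∀ i ∈ σ, m (F.ray i) = -a i) ∧ ∀ i, -a i ≤ m (F.ray i)

/-- The lattice points of the Mori cone: the integral relations `β` between the `v_i` that are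
nonnegative on all nef divisors, where `(D_i, β) = β_i`. -/
def moriPoints (F : ToricFan M ι) : Set (ι → ℤ) :=
  {β | ∑ i, β i • F.ray i = 0 ∧ ∀ a : ι → ℚ, F.IsNef a → 0 ≤ ∑ i, a i * (β i : ℚ)}

/-! ### Morrison-Plesser moduli spaces -/

/-- The homogeneous coordinates of the Morrison-Plesser moduli space: one for each coefficient of a
section `s_i ∈ H^0(ℙ^1, 𝒪(β_i))`; there are `β_i + 1` of them if `β_i ≥ 0` and none otherwise. -/
abbrev MPIndex (β : ι → ℤ) : Type _ := Σ i : ι, Fin (β i + 1).toNat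

/-- The pushout of `M ← ℤ^ι → ℤ^(MPIndex β)`, where `e_i` is sent to `v_i` and to `∑_k e_(i,k)`. -/
abbrev MPPushout (F : ToricFan M ι) (β : ι → ℤ) : Type _ :=
  (M × (MPIndex β → ℤ)) ⧸ Submodule.span ℤ (Set.range fun i : ι =>
    ((F.ray i, fun j => if j.1 = i then -1 else 0) : M × (MPIndex β → ℤ)))

/-- The lattice of the Morrison-Plesser moduli space: the pushout modulo torsion. Its dual consists
of the monomials in the coordinates `z_(i,k)` that have degree `0` when `z_(i,k)` is given the
degree `[D_i]` in the class group of `ℙ`. -/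
abbrev MPLattice (F : ToricFan M ι) (β : ι → ℤ) : Type _ :=
  F.MPPushout β ⧸ Submodule.torsion ℤ (F.MPPushout β)

/-- The Morrison-Plesser moduli space `ℙ_β`: the toric quotient of the space of all tuples of
sections `s_i ∈ H^0(ℙ^1, 𝒪(β_i))`, by the group `Hom(Cl(ℙ), ℂ^*)` that also defines `ℙ` as a
quotient; the tuples kept are those for which the set of all `i` with `s_i = 0` identically is a
cone of the fan of `ℙ`. -/
def morrisonPlesser (F : ToricFan M ι) (β : ι → ℤ) : ToricFan (F.MPLattice β) (MPIndex β) where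
  ray j := Submodule.Quotient.mk (Submodule.Quotient.mk (0, Pi.single j 1))
  cones := {S | Finset.univ.filter (fun i : ι => ∀ k, (⟨i, k⟩ : MPIndex β) ∈ S) ∈ F.cones}

/-- The class in `H^2(ℙ_β, ℚ)` of the divisor of a coordinate `z_(i,0)`, for `β_i ≥ 0`
(and `0` for `β_i < 0`). -/
def coordClass (F : ToricFan M ι) (β : ι → ℤ) (i : ι) : (F.morrisonPlesser β).Cohomology :=
  if h : 0 ≤ β i then
    (F.morrisonPlesser β).toCohomology (MvPolynomial.X ⟨i, ⟨0, by omega⟩⟩)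
  else 0

/-- The image `[D_i] ∈ H^2(ℙ_β, ℚ)` of `[D_i] ∈ H^2(ℙ, ℚ)` under the canonical map. If `β_i ≥ 0`, it
is the class of the divisor of the coordinate `z_(i,0)`. If `β_i < 0`, first use linear equivalence
on `ℙ` to write `[D_i]` in terms of the `[D_j]` with `β_j ≥ 0`, which is possible whenever `ℙ_β` is
not empty. -/
def divisorClass (F : ToricFan M ι) (β : ι → ℤ) (i : ι) : (F.morrisonPlesser β).Cohomology :=
  if 0 ≤ β i then F.coordClass β i
  else if h : ∃ m : M →ₗ[ℤ] ℚ, m (F.ray i) = 1 ∧ ∀ j, j ≠ i → β j < 0 → m (F.ray j) = 0 then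
    -∑ j, h.choose (F.ray j) • F.coordClass β j
  else 0

/-- The Morrison-Plesser class
`Φ_β = ∏_j [E_j]^(E_j, β) * ∏_{(D_i, β) < 0} [D_i]^(-(D_i, β) - 1)` of the partition of the set of
rays into the fibres of `c`, where `E_j = ∑_{c i = j} D_i`. -/
def morrisonPlesserClass (F : ToricFan M ι) {r : ℕ} (c : ι → Fin r) (β : ι → ℤ) :
    (F.morrisonPlesser β).Cohomology :=
  (∏ j : Fin r, (∑ i with c i = j, F.divisorClass β i) ^ (∑ i with c i = j, β i).toNat) *
    ∏ i with β i < 0, F.divisorClass β i ^ (-β i - 1).toNat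

/-- The intersection number `I(P, β) = ∫_{ℙ_β} P([D_1], …, [D_n]) Φ_β`. -/
def intersectionNumber (F : ToricFan M ι) {r : ℕ} (c : ι → Fin r) (P : MvPolynomial ι ℚ)
    (β : ι → ℤ) : ℚ :=
  (F.morrisonPlesser β).integral
    (MvPolynomial.aeval (F.divisorClass β) P * F.morrisonPlesserClass c β)

/-- The generating function `I_P(a) = ∑_β I(P, β) a^β`, summed over the lattice points `β` of the
Mori cone, as a formal power series in the variables `a_i`, for toric varieties whose Mori cone lies
in the nonnegative orthant. -/
def generatingSeries (F : ToricFan M ι) {r : ℕ} (c : ι → Fin r) (P : MvPolynomial ι ℚ) :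
    MvPowerSeries ι ℚ :=
  fun m : ι →₀ ℕ =>
    if (fun i => (m i : ℤ)) ∈ F.moriPoints then F.intersectionNumber c P (fun i => (m i : ℤ)) else 0

end ToricFan

end

/-! Everything reduces to one relation and one cohomology class. The rays span a lattice of rank one
less than their number, and `w` is primitive, so every integral relation between them is an integral
multiple of `w` (`exists_eq_mul_of_sum_eq_zero`). Nefness of `∑ a_i D_i` depends only on the sign of
`∑ a_i w_i`, so the Mori points are the multiples `b w` with `b ≥ 0`. Dually, linear equivalence
forces `[D_i] = w_i D₀` (`exists_toCohomology_X_eq`), and the normalization of integration at one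
maximal cone gives `∫ D₀ ^ dim = 1 / ∏ w_i` (`apply_pow_dim`).

The space `ℙ_β` for `β = b w` is of the same kind: the relations between its rays are generated by
the vector in which `w_i` occurs `b w_i + 1` times (`ker_mpMap`). The same two facts therefore apply
to it. Its dimension `d + b ∑ w_i` equals the degree of `P Φ_β`, because `∑ d_j = ∑ w_i`. Hence the
integral is `P(w) ∏ d_j^(b d_j) / ∏ w_i^(b w_i + 1) = ν P(w) μ^b`, and the generating function is a
geometric series in `μ y`. -/

namespace ToricFan.IsWeightedProjectiveSpace

/-! ### Relations between the rays -/

variable {M ι : Type*} [AddCommGroup M] [Fintype ι] {F : ToricFan M ι} {w : ι → ℕ}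

/-- An integral vector that is rationally proportional to a primitive vector is an integral multiple
of it. -/
theorem exists_eq_mul_of_gcd_eq_one (hw : Finset.univ.gcd w = 1) {p q : ℤ} (hp : p ≠ 0)
    {β : ι → ℤ} (h : ∀ i, p * β i = q * w i) : ∃ b : ℤ, ∀ i, β i = b * w i := by
  have hdvd : p.natAbs ∣ q.natAbs := by
    -- `p` divides every `q * w i`, hence also their gcd, which is `q` up to sign.
    have h1 : p.natAbs ∣ Finset.univ.gcd fun i => q.natAbs * w i := by
      refine Finset.dvd_gcd fun i _ => ⟨(β i).natAbs, ?_⟩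
      have := congrArg Int.natAbs (h i)
      simpa [Int.natAbs_mul] using this.symm
    rwa [Finset.gcd_mul_left, hw, mul_one, normalize_eq] at h1
  obtain ⟨b, rfl⟩ := Int.natAbs_dvd_natAbs.1 hdvd
  refine ⟨b, fun i => mul_left_cancel₀ hp ?_⟩
  rw [h i, mul_assoc]

theorem nonempty (hF : F.IsWeightedProjectiveSpace w) : Nonempty ι := by
  rw [← Fintype.card_pos_iff, ← hF.rank]
  omega

theorem linearCombination_surjective (hF : F.IsWeightedProjectiveSpace w) :
    Function.Surjective (Fintype.linearCombination ℤ F.ray) := by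
  rw [← LinearMap.range_eq_top, Fintype.range_linearCombination, hF.span_eq_top]

/-- The lattice of relations between the rays is generated by the vector of weights. -/
theorem exists_eq_mul_of_sum_eq_zero (hF : F.IsWeightedProjectiveSpace w) {β : ι → ℤ}
    (hβ : ∑ i, β i • F.ray i = 0) : ∃ b : ℤ, ∀ i, β i = b * w i := by
  set f := Fintype.linearCombination ℤ F.ray with hf
  have hrank : Module.finrank ℤ (LinearMap.ker f) = 1 := by
    have h1 := (LinearMap.ker f).finrank_quotient_add_finrank
    rw [(f.quotKerEquivOfSurjective hF.linearCombination_surjective).finrank_eq,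
      Module.finrank_fintype_fun_eq_card, ← hF.rank] at h1
    omega
  have hβ' : β ∈ LinearMap.ker f := by
    simpa [hf, Fintype.linearCombination_apply] using hβ
  have hw' : (fun i => (w i : ℤ)) ∈ LinearMap.ker f := by
    simpa [hf, Fintype.linearCombination_apply] using hF.relation
  -- In a relation lattice of rank one, `β` and `w` must be dependent.
  have hdep : ¬ LinearIndependent ℤ ![(⟨β, hβ'⟩ : LinearMap.ker f), ⟨_, hw'⟩] := by
    intro h
    have := h.fintype_card_le_finrank
    simp [hrank] at this
  rw [LinearIndependent.pair_iff] at hdep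
  push Not at hdep
  obtain ⟨s, t, hst, hne⟩ := hdep
  have hst' : ∀ i, s * β i = -t * w i := by
    intro i
    have := congrFun (congrArg Subtype.val hst) i
    simp at this
    linarith
  -- The coefficient `s` of `β` is nonzero: otherwise `t * w i = 0` with `w i > 0` would make `t`
  -- vanish too.
  refine exists_eq_mul_of_gcd_eq_one hF.gcd_eq_one (fun hs => ?_) hst'
  obtain ⟨i⟩ := hF.nonempty
  have h1 := hst' i
  have h2 := hF.pos i
  simp only [hs, zero_mul] at h1
  rcases mul_eq_zero.1 h1.symm with h | h
  · exact hne hs (by omega)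
  · omega

/-- A linear map on the lattice may be prescribed on the rays, subject to the single relation
between them. -/
theorem exists_linearMap (hF : F.IsWeightedProjectiveSpace w) {A : Type*} [AddCommGroup A]
    (x : ι → A) (hx : ∑ i, w i • x i = 0) : ∃ m : M →ₗ[ℤ] A, ∀ i, m (F.ray i) = x i := by
  classical
  set f := Fintype.linearCombination ℤ F.ray with hf
  have hker : LinearMap.ker f ≤ LinearMap.ker (Fintype.linearCombination ℤ x) := by
    intro β hβ
    have hβ' : ∑ i, β i • F.ray i = 0 := by
      simpa [hf, Fintype.linearCombination_apply] using hβ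
    obtain ⟨b, hb⟩ := hF.exists_eq_mul_of_sum_eq_zero hβ'
    rw [LinearMap.mem_ker, Fintype.linearCombination_apply]
    calc ∑ i, β i • x i = b • ∑ i, w i • x i := by
          rw [Finset.smul_sum]
          refine Finset.sum_congr rfl fun i _ => ?_
          rw [hb, mul_smul, natCast_zsmul]
      _ = 0 := by rw [hx, smul_zero]
  refine ⟨((LinearMap.ker f).liftQ _ hker).comp
    (f.quotKerEquivOfSurjective hF.linearCombination_surjective).symm.toLinearMap, fun i => ?_⟩
  have h1 : (f.quotKerEquivOfSurjective hF.linearCombination_surjective).symm (F.ray i) =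
      Submodule.Quotient.mk (Pi.single i 1) := by
    rw [LinearEquiv.symm_apply_eq]
    simp [LinearMap.quotKerEquivOfSurjective, hf]
  rw [LinearMap.comp_apply, LinearEquiv.coe_coe, h1, Submodule.liftQ_apply]
  simp

/-! ### Maximal cones and their multiplicities -/

theorem exists_eq_compl_of_mem_maxCones [DecidableEq ι] (hF : F.IsWeightedProjectiveSpace w)
    {σ : Finset ι} (hσ : σ ∈ F.maxCones) : ∃ i, σ = {i}ᶜ := by
  have h1 : σᶜ.card = 1 := by
    have h2 := hσ.2
    have h3 := hF.rank
    rw [Finset.card_compl, h2, ← h3]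
    simp [dim]
  obtain ⟨i, hi⟩ := Finset.card_eq_one.1 h1
  exact ⟨i, by rw [← hi, compl_compl]⟩

theorem compl_mem_maxCones [DecidableEq ι] (hF : F.IsWeightedProjectiveSpace w) (i : ι) :
    ({i}ᶜ : Finset ι) ∈ F.maxCones := by
  refine ⟨?_, ?_⟩
  · rw [hF.cones_eq]
    intro h
    have : i ∈ ({i}ᶜ : Finset ι) := by rw [h]; exact Finset.mem_univ i
    simp at this
  · rw [Finset.card_compl, Finset.card_singleton, ← hF.rank]
    simp [dim]

/-- The map `M → ZMod (w i)` with `v_i ↦ 1` and all other rays sent to `0` respects the relation,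
because `w i = 0` in the target. Its kernel is the sublattice of the cone, because the relation
expresses `w_i v_i` through the other rays. -/
theorem mult_compl [DecidableEq ι] (hF : F.IsWeightedProjectiveSpace w) (i : ι) :
    F.mult {i}ᶜ = w i := by
  obtain ⟨m, hm⟩ := hF.exists_linearMap (A := ZMod (w i)) (Pi.single i 1) (by
    rw [Finset.sum_eq_single i]
    · simp
    · intro j _ hj
      simp [hj]
    · simp)
  have hsurj : Function.Surjective m := by
    intro z
    obtain ⟨k, rfl⟩ := ZMod.intCast_surjective z
    exact ⟨k • F.ray i, by simp [hm]⟩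
  have hker : LinearMap.ker m = Submodule.span ℤ (F.ray '' (({i}ᶜ : Finset ι) : Set ι)) := by
    have hmem : ∀ j, j ≠ i →
        F.ray j ∈ Submodule.span ℤ (F.ray '' (({i}ᶜ : Finset ι) : Set ι)) :=
      fun j hj => Submodule.subset_span ⟨j, by simpa using hj, rfl⟩
    apply le_antisymm
    · intro x hx
      obtain ⟨β, rfl⟩ := hF.linearCombination_surjective x
      rw [LinearMap.mem_ker, Fintype.linearCombination_apply, map_sum,
        Finset.sum_eq_single i (fun j _ hj => by simp [hm, hj]) (by simp)] at hx
      simp only [map_smul, hm, Pi.single_eq_same, zsmul_eq_mul, mul_one] at hx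
      rw [ZMod.intCast_zmod_eq_zero_iff_dvd] at hx
      obtain ⟨k, hk⟩ := hx
      have hrel : (w i : ℤ) • F.ray i = -∑ j ∈ Finset.univ.erase i, (w j : ℤ) • F.ray j := by
        rw [eq_neg_iff_add_eq_zero, Finset.add_sum_erase _ (fun j => (w j : ℤ) • F.ray j)
          (Finset.mem_univ i)]
        simpa using hF.relation
      rw [Fintype.linearCombination_apply, ← Finset.add_sum_erase _ _ (Finset.mem_univ i)]
      refine Submodule.add_mem _ ?_ (Submodule.sum_mem _ fun j hj =>
        Submodule.smul_mem _ _ (hmem j (Finset.ne_of_mem_erase hj)))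
      rw [hk, mul_comm, mul_smul, hrel]
      exact Submodule.smul_mem _ _ (Submodule.neg_mem _ (Submodule.sum_mem _ fun j hj =>
        Submodule.smul_mem _ _ (hmem j (Finset.ne_of_mem_erase hj))))
    · rw [Submodule.span_le]
      rintro _ ⟨j, hj, rfl⟩
      have hj' : j ≠ i := by simpa using hj
      simp [hm, hj']
  rw [mult, ← hker, Nat.card_congr (m.quotKerEquivOfSurjective hsurj).toEquiv, Nat.card_zmod]

/-! ### The Mori cone -/

/-- Pair the inequality `0 ≤ m(v_j) + a_j` with the weights; the relation kills the contribution of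
`m`. -/
theorem sum_nonneg_of_isNef (hF : F.IsWeightedProjectiveSpace w) {a : ι → ℚ} (ha : F.IsNef a) :
    0 ≤ ∑ i, a i * (w i : ℚ) := by
  classical
  obtain ⟨i⟩ := hF.nonempty
  obtain ⟨m, -, hm⟩ := ha _ (hF.compl_mem_maxCones i)
  have h1 : ∑ j, (w j : ℚ) * m (F.ray j) = 0 := by
    have := congrArg m hF.relation
    simpa using this
  have h2 : 0 ≤ ∑ j, (w j : ℚ) * (m (F.ray j) + a j) :=
    Finset.sum_nonneg fun j _ => mul_nonneg (Nat.cast_nonneg _) (by linarith [hm j])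
  simp only [mul_add, Finset.sum_add_distrib, h1, zero_add] at h2
  simpa [mul_comm] using h2

/-- On the cone omitting `v_i`, the values `-a_j` are forced for `j ≠ i`, and the relation then
determines the value at `v_i`: it exceeds `-a_i` by the degree divided by `w_i`, which is
nonnegative. -/
theorem isNef_of_sum_nonneg (hF : F.IsWeightedProjectiveSpace w) {a : ι → ℚ}
    (ha : 0 ≤ ∑ i, a i * (w i : ℚ)) : F.IsNef a := by
  classical
  intro σ hσ
  obtain ⟨i, rfl⟩ := hF.exists_eq_compl_of_mem_maxCones hσ
  have hwi : (0 : ℚ) < w i := by exact_mod_cast hF.pos i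
  set s := ∑ j, a j * (w j : ℚ) with hs
  obtain ⟨m, hm⟩ := hF.exists_linearMap (A := ℚ)
      (fun j => -a j + Pi.single (M := fun _ => ℚ) i (s / w i) j) (by
    simp only [smul_add, Finset.sum_add_distrib, nsmul_eq_mul, mul_neg, Finset.sum_neg_distrib]
    rw [Finset.sum_eq_single i (f := fun j => (w j : ℚ) * Pi.single (M := fun _ => ℚ) i (s / w i) j)
      (fun j _ hj => by simp [hj]) (by simp), Pi.single_eq_same, mul_div_cancel₀ _ hwi.ne', hs]
    simp [mul_comm])
  refine ⟨m, fun j hj => ?_, fun j => ?_⟩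
  · have hj' : j ≠ i := by simpa using hj
    simp [hm, hj']
  · rw [hm]
    by_cases hj : j = i
    · subst hj
      rw [Pi.single_eq_same]
      have := div_nonneg ha hwi.le
      linarith
    · simp [hj]

theorem moriPoints_eq (hF : F.IsWeightedProjectiveSpace w) :
    F.moriPoints = Set.range fun (b : ℕ) (i : ι) => (b : ℤ) * (w i : ℤ) := by
  classical
  ext β
  constructor
  · rintro ⟨hβ, hnef⟩
    obtain ⟨b, hb⟩ := hF.exists_eq_mul_of_sum_eq_zero hβ
    obtain ⟨i⟩ := hF.nonempty
    have hwi := hF.pos i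
    -- The divisor `D_i` has positive degree, so it is nef and detects the sign of `b`.
    have h1 := hnef (Pi.single i 1) (hF.isNef_of_sum_nonneg (by
      rw [Finset.sum_eq_single i (fun j _ hj => by simp [hj]) (by simp)]
      simp))
    rw [Finset.sum_eq_single i (fun j _ hj => by simp [hj]) (by simp), Pi.single_eq_same,
      one_mul, hb] at h1
    have h2 : 0 ≤ b * (w i : ℤ) := by exact_mod_cast h1
    have h3 : 0 ≤ b := nonneg_of_mul_nonneg_left h2 (by exact_mod_cast hwi)
    lift b to ℕ using h3
    exact ⟨b, funext fun i => (hb i).symm⟩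
  · rintro ⟨b, rfl⟩
    refine ⟨?_, fun a ha => ?_⟩
    · simp only [mul_smul, ← Finset.smul_sum, natCast_zsmul, hF.relation, smul_zero]
    · have := mul_nonneg (Nat.cast_nonneg (α := ℚ) b) (hF.sum_nonneg_of_isNef ha)
      rw [Finset.mul_sum] at this
      refine this.trans_eq (Finset.sum_congr rfl fun i _ => ?_)
      push_cast
      ring

/-! ### Cohomology and integration -/

/-- All toric divisor classes are multiples of one class. -/
theorem exists_toCohomology_X_eq (hF : F.IsWeightedProjectiveSpace w) :
    ∃ D₀ : F.Cohomology, ∀ i, F.toCohomology (MvPolynomial.X i) = (w i : ℚ) • D₀ := by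
  classical
  obtain ⟨i₀⟩ := hF.nonempty
  have h0 : (w i₀ : ℚ) ≠ 0 := by exact_mod_cast (hF.pos i₀).ne'
  refine ⟨(w i₀ : ℚ)⁻¹ • F.toCohomology (MvPolynomial.X i₀), fun i => ?_⟩
  rw [smul_smul]
  have key : (w i₀ : ℚ) • F.toCohomology (MvPolynomial.X i) =
      (w i : ℚ) • F.toCohomology (MvPolynomial.X i₀) := by
    -- This character has divisor `w_{i₀} D_i - w_i D_{i₀}`, which has degree `0`.
    obtain ⟨m, hm⟩ := hF.exists_linearMap (A := ℤ)
      (fun j => Pi.single (M := fun _ => ℤ) i (w i₀ : ℤ) j -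
        Pi.single (M := fun _ => ℤ) i₀ (w i : ℤ) j) (by
        simp only [smul_sub, Finset.sum_sub_distrib]
        rw [Finset.sum_eq_single i (fun j _ hj => by simp [hj]) (by simp),
          Finset.sum_eq_single i₀ (fun j _ hj => by simp [hj]) (by simp)]
        simp [mul_comm])
    rw [← map_smul, ← map_smul, Ideal.Quotient.mkₐ_eq_mk, Ideal.Quotient.eq]
    refine Ideal.mem_sup_right (Ideal.subset_span ⟨m, ?_⟩)
    simp only [hm, Int.cast_sub, map_sub, sub_mul, Finset.sum_sub_distrib]
    rw [Finset.sum_eq_single i (fun j _ hj => by simp [hj]) (by simp),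
      Finset.sum_eq_single i₀ (fun j _ hj => by simp [hj]) (by simp)]
    simp [MvPolynomial.smul_eq_C_mul]
  rw [← smul_right_injective _ h0 |>.eq_iff, key, smul_smul]
  congr 1
  field_simp

theorem aeval_smul_eq {A : Type*} [CommRing A] [Algebra ℚ A] (x : ι → ℚ) (D₀ : A) {k : ℕ}
    {p : MvPolynomial ι ℚ} (hp : p.IsHomogeneous k) :
    MvPolynomial.aeval (fun i => x i • D₀) p = MvPolynomial.eval x p • D₀ ^ k := by
  rw [MvPolynomial.aeval_def, MvPolynomial.eval₂_eq', MvPolynomial.eval_eq', Finset.sum_smul]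
  refine Finset.sum_congr rfl fun s hs => ?_
  have hk : ∑ i, s i = k := by
    rw [← hp (MvPolynomial.mem_support_iff.1 hs), Finsupp.weight_apply,
      Finsupp.sum_fintype _ _ (by simp)]
    simp
  simp only [smul_pow, Finset.prod_smul, Finset.prod_pow_eq_pow_sum, hk, ← Algebra.smul_def,
    smul_smul]

theorem toCohomology_eq_of_isHomogeneous {D₀ : F.Cohomology}
    (hD : ∀ i, F.toCohomology (MvPolynomial.X i) = (w i : ℚ) • D₀) {k : ℕ}
    {p : MvPolynomial ι ℚ} (hp : p.IsHomogeneous k) :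
    F.toCohomology p = MvPolynomial.eval (fun i => (w i : ℚ)) p • D₀ ^ k := by
  rw [← aeval_smul_eq _ _ hp]
  simp only [← hD]
  conv_lhs => rw [← MvPolynomial.aeval_X_left_apply p]
  rw [← MvPolynomial.comp_aeval_apply]

/-- Sending `x_i` to `w_i X` maps the cohomology ring to `ℚ[X] / (X ^ (dim + 1))`: the only non-cone
is the full set of rays, and linear relations have degree `0`. Integration is the coefficient of `X
^ dim` divided by `∏ w_i`; the divisors through the cone omitting `v_i` then give `1 / w_i`, as
`mult_compl` requires. -/
theorem exists_isIntegration (hF : F.IsWeightedProjectiveSpace w) :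
    ∃ φ, F.IsIntegration φ := by
  classical
  set g : MvPolynomial ι ℚ →ₐ[ℚ] Polynomial ℚ :=
    MvPolynomial.aeval fun i => (w i : ℚ) • (Polynomial.X : Polynomial ℚ) with hg
  have hker : F.stanleyReisnerIdeal ⊔ F.linearIdeal ≤
      (Ideal.span {(Polynomial.X : Polynomial ℚ) ^ (F.dim + 1)}).comap g := by
    refine sup_le (Ideal.span_le.2 ?_) (Ideal.span_le.2 ?_)
    · rintro _ ⟨S, hS, rfl⟩
      have hS' : S = Finset.univ := by
        rw [hF.cones_eq] at hS
        simpa using hS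
      subst hS'
      rw [SetLike.mem_coe, Ideal.mem_comap, Ideal.mem_span_singleton]
      have h1 : g (∏ i, MvPolynomial.X i) =
          Polynomial.C (∏ i, (w i : ℚ)) * Polynomial.X ^ (F.dim + 1) := by
        rw [← Polynomial.smul_eq_C_mul, dim, hF.rank, map_prod]
        simp [hg, Finset.prod_smul]
      rw [h1]
      exact dvd_mul_left _ _
    · rintro _ ⟨m, rfl⟩
      rw [SetLike.mem_coe, Ideal.mem_comap]
      have h1 : ∑ i, (m (F.ray i) : ℚ) * w i = 0 := by
        have := congrArg m hF.relation
        simp only [map_sum, map_nsmul, map_zero] at this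
        have h2 := congrArg (Int.cast : ℤ → ℚ) this
        simpa [mul_comm] using h2
      have h3 : g (∑ i, MvPolynomial.C (m (F.ray i) : ℚ) * MvPolynomial.X i) = 0 := by
        rw [map_sum]
        calc _ = ∑ i, ((m (F.ray i) : ℚ) * w i) • (Polynomial.X : Polynomial ℚ) := by
              refine Finset.sum_congr rfl fun i _ => ?_
              rw [map_mul, hg, MvPolynomial.aeval_X, MvPolynomial.aeval_C, mul_smul,
                Algebra.smul_def (m (F.ray i) : ℚ)]
          _ = 0 := by rw [← Finset.sum_smul, h1, zero_smul]
      rw [h3]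
      exact Ideal.zero_mem _
  set ψ : MvPolynomial ι ℚ →ₗ[ℚ] ℚ :=
    (∏ i, (w i : ℚ))⁻¹ • (Polynomial.lcoeff ℚ F.dim).comp g.toLinearMap with hψ
  have hψker : ((F.stanleyReisnerIdeal ⊔ F.linearIdeal).restrictScalars ℚ) ≤
      LinearMap.ker ψ := by
    intro p hp
    have h1 := hker hp
    rw [Ideal.mem_comap, Ideal.mem_span_singleton, Polynomial.X_pow_dvd_iff] at h1
    simp [hψ, h1 F.dim (Nat.lt_succ_self _)]
  have hψhom : ∀ (k : ℕ) (p : MvPolynomial ι ℚ), p.IsHomogeneous k →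
      ψ p = (∏ i, (w i : ℚ))⁻¹ * (MvPolynomial.eval (fun i => (w i : ℚ)) p *
        if F.dim = k then 1 else 0) := by
    intro k p hp
    simp [hψ, hg, aeval_smul_eq _ _ hp, Polynomial.coeff_X_pow]
  refine ⟨((F.stanleyReisnerIdeal ⊔ F.linearIdeal).restrictScalars ℚ).liftQ ψ hψker, ?_, ?_⟩
  · intro k p hp hk
    change ψ p = 0
    rw [hψhom k p hp, if_neg (Ne.symm hk), mul_zero, mul_zero]
  · intro σ hσ
    obtain ⟨i, rfl⟩ := hF.exists_eq_compl_of_mem_maxCones hσ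
    change ψ _ = _
    rw [hψhom F.dim _ (by
      rw [← hσ.2, Finset.card_eq_sum_ones]
      exact MvPolynomial.IsHomogeneous.prod _ _ _ fun j _ => MvPolynomial.isHomogeneous_X _ _),
      if_pos rfl, mul_one, hF.mult_compl, map_prod]
    simp only [MvPolynomial.eval_X]
    have h0 : ∀ j, (w j : ℚ) ≠ 0 := fun j => by exact_mod_cast (hF.pos j).ne'
    rw [← Finset.prod_compl_mul_prod {i}, Finset.prod_singleton]
    have h1 : ∏ j ∈ ({i}ᶜ : Finset ι), (w j : ℚ) ≠ 0 := Finset.prod_ne_zero_iff.2 fun j _ => h0 j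
    have h2 := h0 i
    field_simp

/-- The top self-intersection number of the class `D₀` with `[D_i] = w_i D₀`. -/
theorem apply_pow_dim (hF : F.IsWeightedProjectiveSpace w) {D₀ : F.Cohomology}
    (hD : ∀ i, F.toCohomology (MvPolynomial.X i) = (w i : ℚ) • D₀)
    {φ : F.Cohomology →ₗ[ℚ] ℚ} (hφ : F.IsIntegration φ) :
    φ (D₀ ^ F.dim) = 1 / ∏ i, (w i : ℚ) := by
  classical
  obtain ⟨i⟩ := hF.nonempty
  have h := hφ.maxCone _ (hF.compl_mem_maxCones i)
  have h0 : ∀ j, (w j : ℚ) ≠ 0 := fun j => by exact_mod_cast (hF.pos j).ne'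
  rw [hF.mult_compl, map_prod] at h
  simp only [hD, Finset.prod_smul, Finset.prod_const, (hF.compl_mem_maxCones i).2, map_smul,
    smul_eq_mul] at h
  rw [← Finset.prod_compl_mul_prod {i}, Finset.prod_singleton]
  have h1 : ∏ j ∈ ({i}ᶜ : Finset ι), (w j : ℚ) ≠ 0 := Finset.prod_ne_zero_iff.2 fun j _ => h0 j
  rw [one_div, mul_inv, ← one_div (w i : ℚ), ← h]
  field_simp

/-- A homogeneous class of top degree is a multiple of `D₀ ^ dim`, whose integral is known; other
degrees integrate to `0`, and monomials span. -/
theorem existsUnique_isIntegration (hF : F.IsWeightedProjectiveSpace w) :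
    ∃! φ, F.IsIntegration φ := by
  obtain ⟨φ, hφ⟩ := hF.exists_isIntegration
  refine ⟨φ, hφ, fun ψ hψ => ?_⟩
  obtain ⟨D₀, hD⟩ := hF.exists_toCohomology_X_eq
  have key : ∀ (k : ℕ) (p : MvPolynomial ι ℚ), p.IsHomogeneous k →
      ψ (F.toCohomology p) = φ (F.toCohomology p) := by
    intro k p hk
    by_cases hkd : k = F.dim
    · subst hkd
      rw [toCohomology_eq_of_isHomogeneous hD hk, map_smul, map_smul, hF.apply_pow_dim hD hφ,
        hF.apply_pow_dim hD hψ]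
    · rw [hψ.eq_zero_of_ne k _ hk hkd, hφ.eq_zero_of_ne k _ hk hkd]
  have hcomp : ψ.comp F.toCohomology.toLinearMap = φ.comp F.toCohomology.toLinearMap :=
    MvPolynomial.linearMap_ext fun s => LinearMap.ext fun a =>
      key _ _ (MvPolynomial.isHomogeneous_monomial a rfl)
  refine LinearMap.ext fun x => ?_
  obtain ⟨p, rfl⟩ := Ideal.Quotient.mkₐ_surjective ℚ _ x
  exact LinearMap.congr_fun hcomp p

theorem isIntegration_integral (hF : F.IsWeightedProjectiveSpace w) :
    F.IsIntegration F.integral := by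
  rw [integral, dif_pos hF.exists_isIntegration]
  exact hF.exists_isIntegration.choose_spec

end ToricFan.IsWeightedProjectiveSpace

namespace ToricFan.IsWeightedProjectiveSpace

variable {M ι : Type*} [AddCommGroup M] {F : ToricFan M ι} {w : ι → ℕ} {b : ℕ} {β : ι → ℤ}

/-! ### Morrison-Plesser moduli spaces -/

theorem nonneg_of_eq_mul (hβ : ∀ i, β i = b * w i) (i : ι) : 0 ≤ β i := by
  rw [hβ]
  positivity

/-- The coordinate of the Morrison-Plesser moduli space belonging to the leading coefficient. -/
def mpZero (hβ : ∀ i, β i = b * w i) (i : ι) : MPIndex β :=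
  ⟨i, ⟨0, by have := nonneg_of_eq_mul hβ i; omega⟩⟩

open scoped Classical in
theorem mk_inl_ray (i : ι) :
    (Submodule.Quotient.mk (F.ray i, 0) : F.MPPushout β) =
      Submodule.Quotient.mk (0, fun j => if j.1 = i then 1 else 0) := by
  rw [Submodule.Quotient.eq]
  refine Submodule.subset_span ⟨i, ?_⟩
  ext j
  · simp
  · by_cases h : j.1 = i <;> simp [h]

variable [Fintype ι]

/-- The canonical map to the lattice of the Morrison-Plesser moduli space. -/
def mpMap (F : ToricFan M ι) (β : ι → ℤ) : (MPIndex β → ℤ) →ₗ[ℤ] F.MPLattice β :=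
  (Submodule.mkQ _).comp ((Submodule.mkQ _).comp (LinearMap.inr ℤ M (MPIndex β → ℤ)))

theorem mpMap_single [DecidableEq (MPIndex β)] (j : MPIndex β) :
    mpMap F β (Pi.single j 1) = (F.morrisonPlesser β).ray j := by
  simp only [mpMap, morrisonPlesser, LinearMap.comp_apply, LinearMap.inr_apply,
    Submodule.mkQ_apply]
  -- The two sides differ only in the decidability instance inside `Pi.single`.
  congr!

/-- In the pushout `v_i` equals `∑_k e_(i,k)`, and the `v_i` generate `M`, so the summand `M`
contributes nothing new. -/
theorem mpMap_surjective (hF : F.IsWeightedProjectiveSpace w) :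
    Function.Surjective (mpMap F β) := by
  classical
  refine (Submodule.mkQ_surjective _).comp (LinearMap.range_eq_top.1 (eq_top_iff.2 ?_))
  rintro x -
  obtain ⟨⟨m, y⟩, rfl⟩ := Submodule.mkQ_surjective _ x
  set g : (MPIndex β → ℤ) →ₗ[ℤ] F.MPPushout β :=
    (Submodule.mkQ _).comp (LinearMap.inr ℤ M (MPIndex β → ℤ)) with hg
  set h : M →ₗ[ℤ] F.MPPushout β :=
    (Submodule.mkQ _).comp (LinearMap.inl ℤ M (MPIndex β → ℤ)) with hh
  have hsplit : (Submodule.Quotient.mk (m, y) : F.MPPushout β) = h m + g y := by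
    rw [hg, hh, LinearMap.comp_apply, LinearMap.comp_apply, ← map_add]
    simp
  have hm : LinearMap.range h ≤ LinearMap.range g := by
    rw [LinearMap.range_eq_map, ← hF.span_eq_top, Submodule.map_span, Submodule.span_le]
    rintro _ ⟨_, ⟨i, rfl⟩, rfl⟩
    exact ⟨_, (mk_inl_ray i).symm⟩
  rw [Submodule.mkQ_apply, hsplit]
  exact Submodule.add_mem _ (hm ⟨m, rfl⟩) ⟨y, rfl⟩

/-- The repeated weight vector is `∑_i w_i ∑_k e_(i,k)`, whose image is that of `∑ w_i v_i = 0`. -/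
theorem mpMap_weights (hF : F.IsWeightedProjectiveSpace w) :
    mpMap F β (fun j => (w j.1 : ℤ)) = 0 := by
  classical
  have h1 : (fun j : MPIndex β => (w j.1 : ℤ)) =
      ∑ i, (w i : ℤ) • fun j : MPIndex β => if j.1 = i then (1 : ℤ) else 0 := by
    ext j
    simp
  rw [h1, map_sum]
  have h2 : ∀ i, mpMap F β (fun j => if j.1 = i then (1 : ℤ) else 0) =
      ((Submodule.mkQ _).comp ((Submodule.mkQ _).comp (LinearMap.inl ℤ M (MPIndex β → ℤ))) :
        M →ₗ[ℤ] F.MPLattice β) (F.ray i) := by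
    intro i
    exact (congrArg Submodule.Quotient.mk (mk_inl_ray i)).symm
  simp only [map_smul, h2]
  simp only [← map_smul, ← map_sum]
  rw [show ∑ i, (w i : ℤ) • F.ray i = 0 by simpa using hF.relation, map_zero]

theorem gcd_weights_eq_one (hF : F.IsWeightedProjectiveSpace w) (hβ : ∀ i, β i = b * w i) :
    Finset.univ.gcd (fun j : MPIndex β => w j.1) = 1 := by
  rw [← Nat.dvd_one, ← hF.gcd_eq_one]
  exact Finset.dvd_gcd fun i _ => Finset.gcd_dvd (f := fun j : MPIndex β => w j.1)
    (Finset.mem_univ (mpZero hβ i))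

/-- If `y` dies modulo torsion, some nonzero multiple `a y` is a combination of the pushout
relations. Its `M`-component makes the coefficients a multiple of `w`, so `a y` is proportional to
the repeated weights; these are primitive, so `a` can be cancelled. -/
theorem ker_mpMap (hF : F.IsWeightedProjectiveSpace w) (hβ : ∀ i, β i = b * w i) :
    LinearMap.ker (mpMap F β) = Submodule.span ℤ {fun j => (w j.1 : ℤ)} := by
  classical
  apply le_antisymm
  · intro y hy
    have h1 : (Submodule.Quotient.mk (0, y) : F.MPPushout β) ∈
        Submodule.torsion ℤ (F.MPPushout β) := (Submodule.Quotient.mk_eq_zero _).1 hy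
    obtain ⟨⟨a, ha⟩, h2⟩ := (Submodule.mem_torsion_iff _).1 h1
    have h3 : ((0, a • y) : M × (MPIndex β → ℤ)) ∈ Submodule.span ℤ (Set.range fun i : ι =>
        ((F.ray i, fun j => if j.1 = i then -1 else 0) : M × (MPIndex β → ℤ))) := by
      rw [← Submodule.Quotient.mk_eq_zero,
        show ((0, a • y) : M × (MPIndex β → ℤ)) = a • (0, y) by simp]
      exact h2
    obtain ⟨x, hx⟩ := (Submodule.mem_span_range_iff_exists_fun ℤ).1 h3
    have hx1 : ∑ i, x i • F.ray i = 0 := by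
      simpa [Prod.fst_sum] using congrArg Prod.fst hx
    obtain ⟨t, ht⟩ := hF.exists_eq_mul_of_sum_eq_zero hx1
    have hx2 : ∀ j, a * y j = -t * w j.1 := by
      intro j
      have h4 := congrFun (congrArg Prod.snd hx) j
      simp only [Prod.snd_sum, Prod.smul_snd, Finset.sum_apply, Pi.smul_apply, smul_eq_mul,
        mul_ite, mul_neg, mul_one, mul_zero, Finset.sum_ite_eq, Finset.mem_univ, if_true, ht] at h4
      rw [← h4, neg_mul]
    obtain ⟨s, hs⟩ := exists_eq_mul_of_gcd_eq_one (hF.gcd_weights_eq_one hβ)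
      (nonZeroDivisors.ne_zero ha) hx2
    exact Submodule.mem_span_singleton.2 ⟨s, funext fun j => (hs j).symm⟩
  · rw [Submodule.span_singleton_le_iff_mem]
    exact hF.mpMap_weights

theorem morrisonPlesser (hF : F.IsWeightedProjectiveSpace w) (hβ : ∀ i, β i = b * w i) :
    (F.morrisonPlesser β).IsWeightedProjectiveSpace (fun j => w j.1) := by
  classical
  refine ⟨fun j => hF.pos _, hF.gcd_weights_eq_one hβ, ?_, ?_, ?_, ?_⟩
  · have h1 := (LinearMap.ker (mpMap F β)).finrank_quotient_add_finrank
    obtain ⟨i⟩ := hF.nonempty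
    have h0 : (fun j : MPIndex β => (w j.1 : ℤ)) ≠ 0 := fun h => by
      have h2 := congrFun h (mpZero hβ i)
      have h3 := hF.pos i
      simp only [mpZero, Pi.zero_apply] at h2
      omega
    rw [((mpMap F β).quotKerEquivOfSurjective hF.mpMap_surjective).finrank_eq,
      Module.finrank_fintype_fun_eq_card, hF.ker_mpMap hβ,
      ← (LinearEquiv.toSpanNonzeroSingleton ℤ _ _ h0).finrank_eq, Module.finrank_self] at h1
    exact h1
  · have h1 : (F.morrisonPlesser β).ray = fun j => mpMap F β (Pi.single j 1) :=
      funext fun j => (mpMap_single j).symm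
    rw [h1, Set.range_comp' (mpMap F β), ← Submodule.map_span, eq_top_iff,
      ← LinearMap.range_eq_top.2 (hF.mpMap_surjective (β := β)), LinearMap.range_eq_map]
    refine Submodule.map_mono ?_
    have h2 : (fun j => Pi.single j 1 : MPIndex β → MPIndex β → ℤ) = Pi.basisFun ℤ (MPIndex β) :=
      funext fun j => (Pi.basisFun_apply ℤ _ j).symm
    rw [h2, (Pi.basisFun ℤ (MPIndex β)).span_eq]
  · have h1 := hF.mpMap_weights (β := β)
    rw [← Finset.univ_sum_single (fun j : MPIndex β => (w j.1 : ℤ)), map_sum] at h1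
    rw [← h1]
    refine Finset.sum_congr rfl fun j _ => ?_
    rw [← mpMap_single, ← map_nsmul]
    congr 1
    ext k
    by_cases h : k = j <;> simp [h]
  · ext S
    change _ ∈ F.cones ↔ _
    rw [hF.cones_eq]
    simp only [Set.mem_ofPred_eq, ne_eq, Finset.eq_univ_iff_forall, Finset.mem_filter,
      Finset.mem_univ, true_and]
    -- All sections vanish identically exactly when all coordinates lie in `S`.
    refine not_congr ⟨fun h j => h j.1 j.2, fun h i k => h _⟩

/-! ### Divisor classes and intersection numbers on the moduli spaces -/

theorem divisorClass_eq (hβ : ∀ i, β i = b * w i) (i : ι) :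
    F.divisorClass β i =
      (F.morrisonPlesser β).toCohomology (MvPolynomial.X (mpZero hβ i)) := by
  have h := nonneg_of_eq_mul hβ i
  rw [divisorClass, if_pos h, coordClass, dif_pos h]
  rfl

theorem morrisonPlesserClass_eq {r : ℕ} {c : ι → Fin r} {deg : Fin r → ℕ}
    (hdeg : ∀ j, deg j = ∑ i with c i = j, w i) (hβ : ∀ i, β i = b * w i)
    {D₀ : (F.morrisonPlesser β).Cohomology} (hD : ∀ i, F.divisorClass β i = (w i : ℚ) • D₀) :
    F.morrisonPlesserClass c β = ∏ j, ((deg j : ℚ) • D₀) ^ (deg j * b) := by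
  have hneg : Finset.univ.filter (fun i => β i < 0) = ∅ :=
    Finset.filter_eq_empty_iff.2 fun i _ => not_lt.2 (nonneg_of_eq_mul hβ i)
  rw [morrisonPlesserClass, hneg, Finset.prod_empty, mul_one]
  refine Finset.prod_congr rfl fun j _ => ?_
  have h1 : (∑ i with c i = j, β i).toNat = deg j * b := by
    simp only [hβ, ← Finset.mul_sum]
    rw [← Nat.cast_sum, ← hdeg, ← Nat.cast_mul, Int.toNat_natCast, mul_comm]
  rw [h1, hdeg]
  simp only [hD, ← Finset.sum_smul, Nat.cast_sum]

theorem exists_divisorClass_eq (hF : F.IsWeightedProjectiveSpace w) (hβ : ∀ i, β i = b * w i) :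
    ∃ D₀ : (F.morrisonPlesser β).Cohomology,
      (∀ i, F.divisorClass β i = (w i : ℚ) • D₀) ∧
      (F.morrisonPlesser β).integral (D₀ ^ (F.morrisonPlesser β).dim) =
        1 / ∏ j : MPIndex β, (w j.1 : ℚ) := by
  obtain ⟨D₀, hD⟩ := (hF.morrisonPlesser hβ).exists_toCohomology_X_eq
  exact ⟨D₀, fun i => (divisorClass_eq hβ i).trans (hD _),
    (hF.morrisonPlesser hβ).apply_pow_dim hD (hF.morrisonPlesser hβ).isIntegration_integral⟩

theorem card_mpIndex (hβ : ∀ i, β i = b * w i) :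
    Fintype.card (MPIndex β) = b * ∑ i, w i + Fintype.card ι := by
  have h : ∀ i, (β i + 1).toNat = b * w i + 1 := fun i => by
    rw [hβ]
    norm_cast
  simp [h, Fintype.card_sigma, Finset.sum_add_distrib, Finset.mul_sum]

theorem prod_mpIndex (hβ : ∀ i, β i = b * w i) :
    ∏ j : MPIndex β, (w j.1 : ℚ) = (∏ i, (w i : ℚ)) * (∏ i, (w i : ℚ) ^ w i) ^ b := by
  have h : ∀ i, (β i + 1).toNat = b * w i + 1 := fun i => by
    rw [hβ]
    norm_cast
  simp only [Fintype.prod_sigma, Finset.prod_const, Finset.card_univ, Fintype.card_fin, h,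
    pow_succ, Finset.prod_mul_distrib, mul_comm b, pow_mul, Finset.prod_pow]
  rw [mul_comm]

/-- The integrand is a scalar times `D₀ ^ (d + b ∑ d_j)`, and this exponent is exactly the dimension
of `ℙ_β`. The repeated weights in `∫ D₀ ^ dim` supply both `ν` and the denominator of `μ ^ b`. -/
theorem intersectionNumber_eq (hF : F.IsWeightedProjectiveSpace w) {d r : ℕ}
    (hd : Fintype.card ι = d + 1) {c : ι → Fin r} {deg : Fin r → ℕ}
    (hdeg : ∀ j, deg j = ∑ i with c i = j, w i) {P : MvPolynomial ι ℚ} (hP : P.IsHomogeneous d)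
    (hβ : ∀ i, β i = b * w i) :
    F.intersectionNumber c P β =
      1 / (∏ i, (w i : ℚ)) * MvPolynomial.eval (fun i => (w i : ℚ)) P *
        ((∏ j, (deg j : ℚ) ^ deg j) / ∏ i, (w i : ℚ) ^ w i) ^ b := by
  obtain ⟨D₀, hD, hint⟩ := hF.exists_divisorClass_eq hβ
  have hsum : ∑ j, deg j = ∑ i, w i := by
    simp only [hdeg]
    exact Finset.sum_fiberwise _ _ _
  have hdim : (F.morrisonPlesser β).dim = d + (∑ j, deg j) * b := by
    have h1 := (hF.morrisonPlesser hβ).rank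
    rw [card_mpIndex hβ, hd] at h1
    rw [dim, hsum, mul_comm]
    omega
  rw [intersectionNumber, morrisonPlesserClass_eq hdeg hβ hD, funext hD, aeval_smul_eq _ _ hP]
  simp only [smul_pow, Finset.prod_smul, Finset.prod_pow_eq_pow_sum, ← Finset.sum_mul]
  rw [smul_mul_smul_comm, ← pow_add, ← hdim, map_smul, hint, prod_mpIndex hβ, smul_eq_mul]
  simp only [pow_mul, Finset.prod_pow, div_pow]
  field_simp

end ToricFan.IsWeightedProjectiveSpace

namespace ToricFan.IsWeightedProjectiveSpace

variable {M ι : Type*} [AddCommGroup M] [Fintype ι] {F : ToricFan M ι} {w : ι → ℕ}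

/-! ### Generating functions -/

theorem generatingSeries_eq (hF : F.IsWeightedProjectiveSpace w) {r : ℕ} {c : ι → Fin r}
    {P : MvPolynomial ι ℚ} {k μ : ℚ}
    (h : ∀ b : ℕ, F.intersectionNumber c P (fun i => (b : ℤ) * w i) = k * μ ^ b) :
    F.generatingSeries c P = MvPowerSeries.C k *
      (1 - MvPowerSeries.C μ * ∏ i, MvPowerSeries.X i ^ w i)⁻¹ := by
  classical
  obtain ⟨i₀⟩ := hF.nonempty
  have hpos := hF.pos i₀
  set n : ι →₀ ℕ := Finsupp.equivFunOnFinite.symm w with hn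
  have hn' : ∀ i, n i = w i := fun i => rfl
  have hprod : MvPowerSeries.C μ * ∏ i, (MvPowerSeries.X i : MvPowerSeries ι ℚ) ^ w i =
      MvPowerSeries.monomial n μ := by
    have h1 : ∀ s : Finset ι, ∏ i ∈ s, (MvPowerSeries.X i : MvPowerSeries ι ℚ) ^ w i =
        MvPowerSeries.monomial (∑ i ∈ s, Finsupp.single i (w i)) 1 := by
      intro s
      induction s using Finset.induction_on with
      | empty => simp [MvPowerSeries.monomial_zero_eq_C_apply]
      | insert a s ha ih =>
        rw [Finset.prod_insert ha, Finset.sum_insert ha, ih, MvPowerSeries.X_pow_eq,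
          MvPowerSeries.monomial_mul_monomial, one_mul]
    have h2 : ∑ i, Finsupp.single i (w i) = n := by
      ext j
      simp [Finsupp.finsetSum_apply, Finsupp.single_apply, hn']
    rw [h1, h2, ← MvPowerSeries.monomial_zero_eq_C_apply, MvPowerSeries.monomial_mul_monomial,
      zero_add, mul_one]
  have hcoeff : ∀ m : ι →₀ ℕ, MvPowerSeries.coeff m (F.generatingSeries c P) =
      if (fun i => (m i : ℤ)) ∈ F.moriPoints then
        F.intersectionNumber c P (fun i => (m i : ℤ)) else 0 := fun m => rfl
  have hmul : ∀ b : ℕ, MvPowerSeries.coeff (b • n) (F.generatingSeries c P) = k * μ ^ b := by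
    intro b
    have h1 : (fun i => (((b • n) i : ℕ) : ℤ)) = fun i => (b : ℤ) * w i := by
      ext i
      simp [hn']
    rw [hcoeff, h1, if_pos (by rw [hF.moriPoints_eq]; exact ⟨b, rfl⟩), h]
  have hzero : ∀ m : ι →₀ ℕ, (∀ b : ℕ, m ≠ b • n) →
      MvPowerSeries.coeff m (F.generatingSeries c P) = 0 := by
    intro m hm
    rw [hcoeff, if_neg]
    rw [hF.moriPoints_eq]
    rintro ⟨b, hb⟩
    refine hm b (Finsupp.ext fun i => ?_)
    have : (b : ℤ) * w i = m i := congrFun hb i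
    simp only [Finsupp.smul_apply, hn', smul_eq_mul]
    exact_mod_cast this.symm
  -- This makes the constant coefficient of `1 - μ y` equal to `1`, so that the inverse power series
  -- is a genuine one.
  have hn0 : n ≠ 0 := fun h0 => by
    have := DFunLike.congr_fun h0 i₀
    rw [hn', Finsupp.zero_apply] at this
    omega
  rw [hprod, MvPowerSeries.eq_mul_inv_iff_mul_eq (by
    rw [map_sub, map_one, ← MvPowerSeries.coeff_zero_eq_constantCoeff_apply,
      MvPowerSeries.coeff_monomial, if_neg hn0.symm]
    simp)]
  ext m
  -- Writing `c_m` for the coefficients of the series, it remains to see `c_m - μ c_(m-n) = k` for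
  -- `m = 0` and `0` otherwise, the second term being absent unless `n ≤ m`. Along the multiples of
  -- `n` this telescopes.
  rw [mul_sub, mul_one, map_sub, MvPowerSeries.coeff_mul_monomial, MvPowerSeries.coeff_C]
  by_cases hm : ∃ b : ℕ, m = b • n
  · obtain ⟨b, rfl⟩ := hm
    rw [hmul]
    cases b with
    | zero =>
      have : ¬ n ≤ 0 := fun h0 => hn0 (nonpos_iff_eq_zero.1 h0)
      simp [this]
    | succ b =>
      have h1 : (b + 1) • n ≠ 0 := by simp [hn0]
      rw [if_neg h1, succ_nsmul, if_pos le_add_self, add_tsub_cancel_right, hmul]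
      ring
  · push Not at hm
    have h0 : m ≠ 0 := by simpa using hm 0
    rw [hzero m hm, if_neg h0]
    split_ifs with hle
    -- If `m` is not a multiple of `n`, neither is `m - n`.
    · rw [hzero, zero_mul, sub_zero]
      intro b hb
      refine hm (b + 1) ?_
      rw [succ_nsmul, ← hb, tsub_add_cancel_of_le hle]
    · rw [sub_zero]

theorem hasSum_intersectionNumber (hF : F.IsWeightedProjectiveSpace w) {r : ℕ} {c : ι → Fin r}
    {P : MvPolynomial ι ℚ} {k μ : ℚ}
    (h : ∀ b : ℕ, F.intersectionNumber c P (fun i => (b : ℤ) * w i) = k * μ ^ b)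
    (a : ι → ℂ) (ha : ‖(μ : ℂ) * ∏ i, a i ^ w i‖ < 1) :
    HasSum (fun β : F.moriPoints => (F.intersectionNumber c P β.1 : ℂ) * ∏ i, a i ^ (β.1 i))
      ((k : ℂ) / (1 - (μ : ℂ) * ∏ i, a i ^ w i)) := by
  obtain ⟨i₀⟩ := hF.nonempty
  have hpos := hF.pos i₀
  have hinj : Function.Injective fun (b : ℕ) (i : ι) => (b : ℤ) * (w i : ℤ) := by
    intro b b' hb
    have h1 : (b : ℤ) * w i₀ = b' * w i₀ := congrFun hb i₀
    exact_mod_cast mul_right_cancel₀ (by exact_mod_cast hpos.ne') h1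
  -- Positivity of one weight makes `b ↦ b w` injective, so the sum over Mori points is a sum over
  -- `b`.
  set e : ℕ ≃ F.moriPoints :=
    (Equiv.ofInjective _ hinj).trans (Equiv.setCongr hF.moriPoints_eq.symm) with he
  have he' : ∀ b : ℕ, (e b).1 = fun i => (b : ℤ) * (w i : ℤ) := fun b => rfl
  rw [← e.hasSum_iff]
  rw [div_eq_mul_inv]
  have hgeom := (hasSum_geometric_of_norm_lt_one ha).mul_left (k : ℂ)
  refine (congrArg (fun f : ℕ → ℂ => HasSum f _) (funext fun b => ?_)).mpr hgeom
  simp only [Function.comp_apply, he', h]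
  have h1 : ∀ i, a i ^ ((b : ℤ) * (w i : ℤ)) = (a i ^ w i) ^ b := fun i => by
    rw [← Nat.cast_mul, zpow_natCast, mul_comm, pow_mul]
  simp only [h1, Finset.prod_pow]
  push_cast
  rw [mul_pow, mul_assoc]

end ToricFan.IsWeightedProjectiveSpace

theorem mainTheorem2 {M : Type*} [AddCommGroup M] [Module.Free ℤ M] [Module.Finite ℤ M]
    (d r : ℕ) (w : Fin (d + 1) → ℕ) (F : ToricFan M (Fin (d + 1)))
    (hF : F.IsWeightedProjectiveSpace w)
    (hGorenstein : ∀ i, w i ∣ ∑ k, w k)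
    (c : Fin (d + 1) → Fin r) (hc : Function.Surjective c)
    (deg : Fin r → ℕ) (hdeg : ∀ j, deg j = ∑ i with c i = j, w i)
    (P : MvPolynomial (Fin (d + 1)) ℚ) (hP : P.IsHomogeneous d)
    (ν μ : ℚ) (hν : ν = 1 / ∏ i, (w i : ℚ))
    (hμ : μ = (∏ j, (deg j : ℚ) ^ deg j) / ∏ i, (w i : ℚ) ^ w i) :
    -- the lattice points of the Mori cone are the multiples `b w`
    F.moriPoints = Set.range (fun (b : ℕ) (i : Fin (d + 1)) => (b : ℤ) * (w i : ℤ)) ∧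
    -- the Morrison-Plesser moduli spaces, their classes, and the intersection numbers
    (∀ (b : ℕ) (β : Fin (d + 1) → ℤ), (∀ i, β i = (b : ℤ) * (w i : ℤ)) →
      (F.morrisonPlesser β).IsWeightedProjectiveSpace (fun j => w j.1) ∧
      (∃! φ, (F.morrisonPlesser β).IsIntegration φ) ∧
      (∃ D₀ : (F.morrisonPlesser β).Cohomology,
        (∀ i, F.divisorClass β i = (w i : ℚ) • D₀) ∧
        F.morrisonPlesserClass c β = ∏ j, ((deg j : ℚ) • D₀) ^ (deg j * b)) ∧
      F.intersectionNumber c P β =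
        ν * MvPolynomial.eval (fun i => (w i : ℚ)) P * μ ^ b) ∧
    -- the generating function as a formal power series
    F.generatingSeries c P =
      MvPowerSeries.C (ν * MvPolynomial.eval (fun i => (w i : ℚ)) P) *
        (1 - MvPowerSeries.C μ * ∏ i, MvPowerSeries.X i ^ w i)⁻¹ ∧
    -- the generating function as a convergent series
    (∀ a : Fin (d + 1) → ℂ, ‖(μ : ℂ) * ∏ i, a i ^ w i‖ < 1 →
      HasSum (fun β : F.moriPoints =>
          (F.intersectionNumber c P β.1 : ℂ) * ∏ i, a i ^ (β.1 i))
        (((ν * MvPolynomial.eval (fun i => (w i : ℚ)) P : ℚ) : ℂ) /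
          (1 - (μ : ℂ) * ∏ i, a i ^ w i))) := by
  subst hν hμ
  have key : ∀ (b : ℕ) (β : Fin (d + 1) → ℤ), (∀ i, β i = (b : ℤ) * (w i : ℤ)) →
      F.intersectionNumber c P β = 1 / (∏ i, (w i : ℚ)) *
        MvPolynomial.eval (fun i => (w i : ℚ)) P *
          ((∏ j, (deg j : ℚ) ^ deg j) / ∏ i, (w i : ℚ) ^ w i) ^ b :=
    fun b β hβ => hF.intersectionNumber_eq (by simp) hdeg hP hβ
  refine ⟨hF.moriPoints_eq, fun b β hβ => ⟨hF.morrisonPlesser hβ,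
    (hF.morrisonPlesser hβ).existsUnique_isIntegration, ?_, key b β hβ⟩,
    hF.generatingSeries_eq fun b => key b _ fun _ => rfl,
    fun a ha => hF.hasSum_intersectionNumber (fun b => key b _ fun _ => rfl) a ha⟩
  obtain ⟨D₀, hD, -⟩ := hF.exists_divisorClass_eq hβ
  exact ⟨D₀, hD, ToricFan.IsWeightedProjectiveSpace.morrisonPlesserClass_eq hdeg hβ hD⟩
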